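/- Let $\mathbf G=(g_{ij})$ be an arbitrary $N\times N$ matrix ($N\ge 1$) over a field $K$ (e.g. $\mathbb R$ or $\mathbb C$). Let $G^\dagger$ be the weighted digraph with vertex set $\{1,\dots,N\}\cup\{\dagger\}$ whose arcs are the pairs $(i,j)$, $i\ne j$, $g_{ij}\neq 0$, with weight $g_{ij}$, and all pairs $(i,\dagger)$, $1\le i\le N$, with weight $g_{i\dagger}=-\sum_{j=1}^N g_{ij}$. A forest is a digraph without directed circuits in which every outdegree is $0$ or $1$; its trees are its connected components, its roots are the vertices of outdegree $0$. For $1\le n\le N$ let $\mathcal F^k_{\{n,\dagger\}}$ be the set of forests $F$ that are subgraphs of $G^\dagger$ containing all vertices, consist of exactly $k+2$ trees, and have $n$ and $\dagger$ among their roots; let $\mathcal F^k_{\{n,\dagger\}}(m\cdot n)$ be the subset of those containing a directed way from $m$ to $n$ (a way of length $0$ if $m=n$). Let $\pi_F$ be the product of the weights of the arcs of $F$, and put $$D_n(x)=\sum_{k=0}^{N-1}x^k\sum_{F\in\mathcal F^k_{\{n,\dagger\}}}\pi_F,\qquad N_{nm}(x)=\sum_{k=0}^{N-2}x^k\sum_{F\in\mathcal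 F^k_{\{n,\dagger\}}(m\cdot n)}\pi_F\quad(m\ne n).$$ (a) Let $\lambda\in K$ be an eigenvalue of $\mathbf G$ of algebraic multiplicity one, with eigenvector $v$ ($\mathbf Gv=\lambda v$, $v\neq0$). For every $n$ with $v_n\ne0$ and all $m\neq n$ one has $v_m\,D_n(\lambda)=v_n\,N_{nm}(\lambda)$. Hence, whenever $D_n(\lambda)\neq 0$, up to a constant factor the components of $v$ are $$v_n=1,\qquad v_m=\frac{N_{nm}(\lambda)}{D_n(\lambda)}\quad (m\ne n).$$ For $n$ with $v_n\neq0$, the condition $D_n(\lambda)\ne0$ holds if and only if some row vector $w$ with $w\mathbf G=\lambda w$ has $w_n\neq0$; and there is at least one $n$ with $v_n\ne0$ and $D_n(\lambda)\neq0$. (b) Let $\mathbf G_{nm}$ be $\mathbf G$ with the $n$-th row and the $m$-th column struck out. Then $\det(x\mathbf I-\mathbf G_{nn})=D_n(x)$ for all $n$ and all $x\in K$. (c) For $m\neq n$ and $x\in K$ let $\Delta'_{nm}(x)$ be obtained from $x\mathbf I-\mathbf G$ by replacing the $m$-th column by the negative of the $n$-th column and then striking out the $n$-th row and column. Then $\det\Delta'_{nm}(x)=N_{nm}(x)$.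 (d) For all $n,m$, $$\det\mathbf G_{nm}=(-1)^{N+m-n-1}\sum_{F\in\mathcal F^0_{\{n,\dagger\}}(m\cdot n)}\pi_F ,$$ equivalently the cofactor $(-1)^{n+m}\det\mathbf G_{nm}$ of $g_{nm}$ equals $(-1)^{N-1}\sum_{F\in\mathcal F^0_{\{n,\dagger\}}(m\cdot n)}\pi_F$. -/

import Mathlib

open Finset

namespace TreeLike

section Digraph

variable {V : Type*} [DecidableEq V]

/-- The outdegree of the vertex `i` in the digraph on `V` with arc set `F`. -/
def outdegree (F : Finset (V × V)) (i : V) : ℕ :=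
  (F.filter fun a => a.1 = i).card

/-- A digraph on the vertex set `V`, given by its set `F` of arcs, is a forest if every outdegree
is `0` or `1` and there are no directed circuits (loops included). -/
structure IsForest (F : Finset (V × V)) : Prop where
  outdegree_le_one : ∀ i, outdegree F i ≤ 1
  no_dicircuit : ∀ i, ¬ Relation.TransGen (fun a b => (a, b) ∈ F) i i

/-- The vertex `i` is a root: no arc leaves it. -/
def IsRootOf (F : Finset (V × V)) (i : V) : Prop :=
  outdegree F i = 0

/-- The number of trees of a forest, i.e. the number of connected components of the digraph
(all vertices of `V` are vertices of the digraph, orientation is forgotten). -/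
noncomputable def numTrees (F : Finset (V × V)) : ℕ :=
  Nat.card (SimpleGraph.fromRel fun a b => (a, b) ∈ F).ConnectedComponent

/-- In the digraph `F` there is a directed way from `m` to `n`. -/
def HasWay (F : Finset (V × V)) (m n : V) : Prop :=
  Relation.ReflTransGen (fun a b => (a, b) ∈ F) m n

open Classical in
/-- The set `𝓕^k_W` of spanning forests of the digraph with arc set `A`: they have all of `V` as
vertices, exactly `k + |W|` trees, and all elements of `W` are roots. -/
noncomputable def forests (A : Finset (V × V)) (W : Finset V) (k : ℕ) :
    Finset (Finset (V × V)) :=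
  A.powerset.filter fun F =>
    IsForest F ∧ numTrees F = k + W.card ∧ ∀ w ∈ W, IsRootOf F w

/-- The productivity: the product of the weights of all arcs. -/
def productivity {K : Type*} [CommMonoid K] (g : V → V → K) (F : Finset (V × V)) : K :=
  ∏ a ∈ F, g a.1 a.2

end Digraph

section Dagger

variable {K : Type*} [Field K] {N : ℕ}

/-- The weights of the digraph `G†`; its vertices are `some i` with `i : Fin N`, and the additional
vertex `† = none`. There are no loops, no arc leaves `†`, and the weight of `(i, †)` is
`- ∑ j, G i j`. -/
def daggerWeight (G : Matrix (Fin N) (Fin N) K) : Option (Fin N) → Option (Fin N) → K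
  | some i, some j => if i = j then 0 else G i j
  | some i, none => - ∑ j, G i j
  | none, _ => 0

open Classical in
/-- The arcs of `G†`: the arcs `(i, j)` of `G` (that is `G i j ≠ 0`) with `i ≠ j`, and all the
arcs `(i, †)`. -/
noncomputable def daggerArcs (G : Matrix (Fin N) (Fin N) K) :
    Finset (Option (Fin N) × Option (Fin N)) :=
  Finset.univ.filter fun a =>
    ∃ i : Fin N, a.1 = some i ∧ (a.2 = none ∨ ∃ j : Fin N, a.2 = some j ∧ i ≠ j ∧ G i j ≠ 0)

/-- `𝓕^k_{n,†}(G†)`. -/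
noncomputable def daggerForests (G : Matrix (Fin N) (Fin N) K) (n : Fin N) (k : ℕ) :
    Finset (Finset (Option (Fin N) × Option (Fin N))) :=
  forests (daggerArcs G) {some n, none} k

open Classical in
/-- `𝓕^k_{n,†}(m·n)`: the forests in `𝓕^k_{n,†}(G†)` that contain a way from `m` to `n`. -/
noncomputable def daggerForestsWay (G : Matrix (Fin N) (Fin N) K) (n m : Fin N) (k : ℕ) :
    Finset (Finset (Option (Fin N) × Option (Fin N))) :=
  (daggerForests G n k).filter fun F => HasWay F (some m) (some n)

/-- `∑_{k=0}^{N-1} x^k ∑ π_F` over `F ∈ 𝓕^k_{n,†}`. -/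
noncomputable def forestDen (G : Matrix (Fin N) (Fin N) K) (n : Fin N) (x : K) : K :=
  ∑ k ∈ range N, x ^ k * ∑ F ∈ daggerForests G n k, productivity (daggerWeight G) F

/-- `∑_{k=0}^{N-2} x^k ∑ π_F` over `F ∈ 𝓕^k_{n,†}(m·n)`. -/
noncomputable def forestNum (G : Matrix (Fin N) (Fin N) K) (n m : Fin N) (x : K) : K :=
  ∑ k ∈ range (N - 1), x ^ k * ∑ F ∈ daggerForestsWay G n m k, productivity (daggerWeight G) F

end Dagger

section Minors

variable {K : Type*} [Field K] {M : ℕ}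

/-- The matrix `G_{nm}`: the `n`-th row and the `m`-th column are struck out. -/
def minorMatrix (G : Matrix (Fin (M + 1)) (Fin (M + 1)) K) (n m : Fin (M + 1)) :
    Matrix (Fin M) (Fin M) K :=
  G.submatrix n.succAbove m.succAbove

/-- The matrix `Δ'_{nm}(x)` of Cramer's rule, for `m ≠ n`: in `x I - G` the `m`-th column is
replaced by the `n`-th one with negative sign, then the `n`-th row and column are struck out. -/
def cramerMatrix (G : Matrix (Fin (M + 1)) (Fin (M + 1)) K) (n m : Fin (M + 1)) (x : K) :
    Matrix (Fin M) (Fin M) K :=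
  minorMatrix
    ((x • (1 : Matrix (Fin (M + 1)) (Fin (M + 1)) K) - G).updateCol m
      (fun i => -((x • (1 : Matrix (Fin (M + 1)) (Fin (M + 1)) K) - G) i n))) n n

end Minors

end TreeLike

/-! Everything reduces to one identity: entry `(m, n)` of the adjugate of `x I - G` is the forest
sum, `forestDen` for `m = n` and `forestNum` otherwise.

The weights into † make `x I - G` the non-† block of a Laplacian on all vertices in which `n` and †
are forced roots. Each row of that Laplacian is a weighted sum of choices: stay a root (weight `x`
outside the forced roots) or send out one arc. Multilinearity of the determinant turns the adjugate
entry into a sum over partial functions. A choice with a circuit contributes zero; an acyclic one is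
a forest, and its determinant is 1 or 0 according to whether `m` reaches `n`
(`adjugate_rootedLaplacian`). The minors and the Cramer determinant are then adjugate entries up to
sign.

For eigenvectors, a kernel vector makes the columns of the adjugate proportional to it
(`mul_adjugate_eq_of_mulVec_eq_zero`). The trace of the adjugate is the derivative of the
characteristic polynomial, nonzero at a simple root; this decides when the denominator is nonzero.
-/

namespace TreeLike

/-! ### Following the arcs of a partial function. -/

section Reachability

variable {V : Type*}

/-- Since at most one arc leaves each vertex and none leaves `r`, crossing an arc in either
direction does not change whether `r` is reached. This yields uniqueness of the root in a component.
-/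
theorem reachable_iff_of_reachable {p : V → Option V} {a b r : V} (hr : p r = none)
    (h : (SimpleGraph.fromRel fun a b => p a = some b).Reachable a b) :
    Relation.ReflTransGen (fun a b => p a = some b) a r ↔
      Relation.ReflTransGen (fun a b => p a = some b) b r := by
  have step : ∀ {c d : V}, p c = some d →
      (Relation.ReflTransGen (fun a b => p a = some b) c r ↔
        Relation.ReflTransGen (fun a b => p a = some b) d r) := by
    intro c d hcd
    refine ⟨fun h => ?_, fun h => h.head hcd⟩
    rcases h.cases_head with rfl | ⟨e, hce, her⟩
    · simp [hr] at hcd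
    · rw [hcd] at hce
      rwa [Option.some.inj hce]
  rw [SimpleGraph.reachable_iff_reflTransGen] at h
  induction h with
  | refl => rfl
  | tail _ hadj ih =>
    refine Iff.trans ih ?_
    rcases (SimpleGraph.fromRel_adj _ _ _).1 hadj with ⟨_, h | h⟩
    · exact step h
    · exact (step h).symm

theorem reachable_of_reflTransGen {p : V → Option V} {a b : V}
    (h : Relation.ReflTransGen (fun a b => p a = some b) a b) :
    (SimpleGraph.fromRel fun a b => p a = some b).Reachable a b := by
  induction h with
  | refl => rfl
  | @tail c d _ hcd ih =>
    by_cases hne : c = d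
    · rwa [← hne]
    · exact ih.trans (SimpleGraph.Adj.reachable
        ((SimpleGraph.fromRel_adj _ _ _).2 ⟨hne, Or.inl hcd⟩))

theorem exists_root [Finite V] {p : V → Option V}
    (hp : ∀ i, ¬ Relation.TransGen (fun a b => p a = some b) i i) (i : V) :
    ∃ r, p r = none ∧ Relation.ReflTransGen (fun a b => p a = some b) i r := by
  let R : V → V → Prop := fun a b => Relation.TransGen (fun a b => p a = some b) b a
  have : IsTrans V R := ⟨fun a b c hab hbc => hbc.trans hab⟩
  have : Std.Irrefl R := ⟨hp⟩
  have hwf : WellFounded R := Finite.wellFounded_of_trans_of_irrefl R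
  induction i using hwf.induction with
  | _ i ih =>
    cases hi : p i with
    | none => exact ⟨i, hi, .refl⟩
    | some j =>
      obtain ⟨r, hr, hjr⟩ := ih j (.single hi)
      exact ⟨r, hr, hjr.head hi⟩

end Reachability

/-! ### Forests as acyclic partial functions. -/

section PartialFunctions

variable {V : Type*} [DecidableEq V] [Fintype V]

/-- The digraph of a partial function `p`: it has an arc from `i` to `j` if `p i = some j`. -/
def arcsOf (p : V → Option V) : Finset (V × V) :=
  univ.filter fun a => p a.1 = some a.2

@[simp]
theorem mem_arcsOf {p : V → Option V} {i j : V} : (i, j) ∈ arcsOf p ↔ p i = some j := by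
  simp [arcsOf]

theorem filter_arcsOf (p : V → Option V) (i : V) :
    ((arcsOf p).filter fun a => a.1 = i) = (p i).toFinset.image fun j => (i, j) := by
  ext ⟨a, b⟩
  simp only [mem_filter, mem_arcsOf, mem_image, Option.mem_toFinset, Option.mem_def,
    Prod.mk.injEq, exists_eq_right_right]
  constructor
  · rintro ⟨h, rfl⟩
    exact ⟨h, rfl⟩
  · rintro ⟨h, rfl⟩
    exact ⟨h, rfl⟩

theorem outdegree_arcsOf (p : V → Option V) (i : V) :
    outdegree (arcsOf p) i = (p i).toFinset.card := by
  rw [outdegree, filter_arcsOf, card_image_of_injective _ (Prod.mk_right_injective i)]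

theorem isRootOf_arcsOf {p : V → Option V} {i : V} : IsRootOf (arcsOf p) i ↔ p i = none := by
  rw [IsRootOf, outdegree_arcsOf]
  cases p i <;> simp

theorem isForest_arcsOf {p : V → Option V} :
    IsForest (arcsOf p) ↔ ∀ i, ¬ Relation.TransGen (fun a b => p a = some b) i i := by
  constructor
  · intro h
    simpa using h.no_dicircuit
  · intro h
    refine ⟨fun i => ?_, by simpa using h⟩
    rw [outdegree_arcsOf]
    cases p i <;> simp

theorem hasWay_arcsOf {p : V → Option V} {m n : V} :
    HasWay (arcsOf p) m n ↔ Relation.ReflTransGen (fun a b => p a = some b) m n := by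
  simp [HasWay]

theorem arcsOf_injective : Function.Injective (arcsOf : (V → Option V) → Finset (V × V)) := by
  intro p q h
  ext i j
  rw [← mem_arcsOf, h, mem_arcsOf]

theorem exists_arcsOf_eq {F : Finset (V × V)} (h : ∀ i, outdegree F i ≤ 1) :
    ∃ p, arcsOf p = F := by
  classical
  refine ⟨fun i => if h : ∃ j, (i, j) ∈ F then some h.choose else none, ?_⟩
  ext ⟨i, j⟩
  rw [mem_arcsOf]
  have huniq : ∀ {j k}, (i, j) ∈ F → (i, k) ∈ F → j = k := by
    intro j k hj hk
    have := card_le_one.1 (h i) (i, j) (by simp [hj]) (i, k) (by simp [hk])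
    exact (Prod.mk.inj this).2
  constructor
  · intro hj
    split_ifs at hj with hex
    rw [← Option.some.inj hj]
    exact hex.choose_spec
  · intro hj
    have hex : ∃ j, (i, j) ∈ F := ⟨j, hj⟩
    rw [dif_pos hex, huniq hex.choose_spec hj]

theorem productivity_arcsOf {K : Type*} [CommMonoid K] (g : V → V → K) (p : V → Option V) :
    productivity g (arcsOf p) = ∏ i, (p i).elim 1 (g i) := by
  rw [productivity, ← prod_fiberwise _ Prod.fst]
  refine prod_congr rfl fun i _ => ?_
  rw [filter_arcsOf, prod_image fun _ _ _ _ h => (Prod.mk.inj h).2]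
  cases p i <;> simp

/-- Every tree of a forest has exactly one root. -/
theorem numTrees_arcsOf {p : V → Option V}
    (hp : ∀ i, ¬ Relation.TransGen (fun a b => p a = some b) i i) :
    numTrees (arcsOf p) = (univ.filter fun i => p i = none).card := by
  rw [numTrees, ← Fintype.card_subtype, ← Nat.card_eq_fintype_card]
  simp only [mem_arcsOf]
  symm
  refine Nat.card_eq_of_bijective
    (fun i : {i // p i = none} => SimpleGraph.connectedComponentMk _ i.1) ⟨?_, ?_⟩
  · rintro ⟨i, hi⟩ ⟨j, hj⟩ hij
    have h := (reachable_iff_of_reachable hi (SimpleGraph.ConnectedComponent.eq.1 hij)).1 .refl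
    rcases h.cases_head with h | ⟨e, he, _⟩
    · exact Subtype.ext h.symm
    · simp [hj] at he
  · intro c
    induction c using SimpleGraph.ConnectedComponent.ind with
    | _ i =>
      obtain ⟨r, hr, hir⟩ := exists_root hp i
      exact ⟨⟨r, hr⟩, SimpleGraph.ConnectedComponent.sound (reachable_of_reflTransGen hir).symm⟩

end PartialFunctions

/-! ### Determinants attached to partial functions. -/

section Determinants

variable {V K : Type*} [DecidableEq V] [Fintype V] [CommRing K]

theorem det_sum_smul_rows {T : Type*} [Fintype T] (c : V → T → K) (b : V → T → V → K) :
    (Matrix.of fun i => ∑ t, c i t • b i t).det =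
      ∑ p : V → T, (∏ i, c i (p i)) * (Matrix.of fun i => b i (p i)).det := by
  have h := (Matrix.detRowAlternating (R := K) (n := V)).toMultilinearMap.map_sum
    (fun i t => c i t • b i t)
  refine h.trans (sum_congr rfl fun p _ => ?_)
  exact MultilinearMap.map_smul_univ _ _ _

/-- The row of the matrix of a partial function: `e_i`, or `e_i - e_j` if there is an arc from
`i` to `j`. -/
def arcRow (K : Type*) [CommRing K] (i : V) (t : Option V) : V → K :=
  Pi.single i 1 - t.elim 0 fun j => Pi.single j 1

/-- The number of proper ancestors strictly increases along arcs, so ordering by it makes the matrix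
block triangular with identity diagonal blocks. -/
theorem det_arcRow_of_acyclic {p : V → Option V}
    (hp : ∀ i, ¬ Relation.TransGen (fun a b => p a = some b) i i) :
    (Matrix.of fun i => arcRow K i (p i)).det = 1 := by
  classical
  let b : V → ℕ := fun i =>
    (univ.filter fun j => Relation.TransGen (fun a b => p a = some b) j i).card
  have hb : ∀ {i j}, p i = some j → b i < b j := by
    intro i j hij
    refine card_lt_card ((ssubset_iff_of_subset fun k => ?_).2 ⟨i, ?_, ?_⟩)
    · simp only [mem_filter, mem_univ, true_and]
      exact fun h => h.tail hij
    · exact mem_filter.2 ⟨mem_univ _, .single hij⟩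
    · exact fun h => hp i (mem_filter.1 h).2
  have hentry : ∀ i j, b j ≤ b i →
      (Matrix.of fun i => arcRow K i (p i)) i j = (1 : Matrix V V K) i j := by
    intro i j hji
    rw [Matrix.one_eq_pi_single, Matrix.of_apply, arcRow]
    cases hi : p i with
    | none => simp
    | some k =>
      have hkj : k ≠ j := by
        rintro rfl
        exact absurd (hb hi) (not_lt.2 hji)
      simp [Pi.single_eq_of_ne' hkj]
  have htri : (Matrix.of fun i => arcRow K i (p i)).BlockTriangular b := by
    intro i j hij
    rw [hentry i j hij.le, Matrix.one_apply_ne]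
    rintro rfl
    exact lt_irrefl _ hij
  rw [htri.det]
  refine prod_eq_one fun k _ => ?_
  have : (Matrix.of fun i => arcRow K i (p i)).toSquareBlock b k = 1 := by
    ext ⟨i, hi⟩ ⟨j, hj⟩
    rw [Matrix.toSquareBlock_def, Matrix.of_apply, hentry i j (hj.trans hi.symm).le,
      Matrix.one_apply, Matrix.one_apply]
    simp
  rw [this, Matrix.det_one]

/-- `det_arcRow_of_acyclic` with the row of a root `n` replaced by `e_m`. -/
theorem det_arcRow_updateRow_of_acyclic {p : V → Option V} {m n : V} (hn : p n = none)
    (hp : ∀ i, ¬ Relation.TransGen (fun a b => p a = some b) i i)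
    [Decidable (Relation.ReflTransGen (fun a b => p a = some b) m n)] :
    ((Matrix.of fun i => arcRow K i (p i)).updateRow n (Pi.single m 1)).det =
      if Relation.ReflTransGen (fun a b => p a = some b) m n then 1 else 0 := by
  classical
  rw [← Matrix.adjugate_apply]
  set A : Matrix V V K := Matrix.of fun i => arcRow K i (p i) with hA
  -- The indicator of the vertices leading to `n` solves `A z = e_n`. As `det A = 1`, the adjugate
  -- inverts `A`, so its column `n` is `z`.
  let z : V → K := fun i => if Relation.ReflTransGen (fun a b => p a = some b) i n then 1 else 0
  have hz : A.mulVec z = Pi.single n 1 := by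
    ext i
    change arcRow K i (p i) ⬝ᵥ z = _
    rw [arcRow, sub_dotProduct, single_one_dotProduct]
    cases hi : p i with
    | none =>
      have hin : Relation.ReflTransGen (fun a b => p a = some b) i n ↔ i = n := by
        refine ⟨fun h => ?_, fun h => h ▸ .refl⟩
        rcases h.cases_head with h | ⟨e, he, _⟩
        · exact h
        · simp [hi] at he
      simp [z, hin, Pi.single_apply]
    | some j =>
      have hne : i ≠ n := by
        rintro rfl
        simp [hi] at hn
      have hij : Relation.ReflTransGen (fun a b => p a = some b) i n ↔
          Relation.ReflTransGen (fun a b => p a = some b) j n := by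
        refine ⟨fun h => ?_, fun h => h.head hi⟩
        rcases h.cases_head with h | ⟨e, he, hen⟩
        · exact absurd h hne
        · rw [hi] at he
          rwa [Option.some.inj he]
      simp [z, hij, hne]
  have h := congrArg (A.adjugate.mulVec) hz
  rw [Matrix.mulVec_mulVec, Matrix.adjugate_mul, det_arcRow_of_acyclic hp, one_smul,
    Matrix.one_mulVec] at h
  have := congrFun h m
  rw [Matrix.mulVec_single_one, Matrix.col_apply] at this
  exact this.symm.trans (by simp only [z]; congr)

/-- The successor map permutes the vertices of a circuit, so their rows `e_i - e_{s i}` sum to zero.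
The root `n` is not among them, so its replaced row plays no role. -/
theorem det_arcRow_updateRow_of_cyclic [IsDomain K] {p : V → Option V} {n : V} (u : V → K)
    (hn : p n = none) {c : V} (hc : Relation.TransGen (fun a b => p a = some b) c c) :
    ((Matrix.of fun i => arcRow K i (p i)).updateRow n u).det = 0 := by
  classical
  let C : Finset V := univ.filter fun i => Relation.TransGen (fun a b => p a = some b) c i ∧
    Relation.TransGen (fun a b => p a = some b) i c
  let s : V → V := fun i => (p i).getD i
  have hcC : c ∈ C := by simp [C, hc]
  have hs : ∀ i ∈ C, p i = some (s i) := by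
    intro i hi
    obtain ⟨j, hj, -⟩ := Relation.TransGen.head'_iff.1 (mem_filter.1 hi).2.2
    simp [s, hj]
  have himage : C.image s = C := by
    ext j
    simp only [mem_image]
    constructor
    · rintro ⟨i, hi, rfl⟩
      obtain ⟨hci, hic⟩ := (mem_filter.1 hi).2
      obtain ⟨j, hj, hjc⟩ := Relation.TransGen.head'_iff.1 hic
      have : s i = j := Option.some.inj ((hs i hi).symm.trans hj)
      subst this
      exact mem_filter.2 ⟨mem_univ _, hci.tail hj, Relation.TransGen.trans_right hjc hc⟩
    · intro hj
      obtain ⟨hcj, hjc⟩ := (mem_filter.1 hj).2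
      obtain ⟨i, hci, hij⟩ := Relation.TransGen.tail'_iff.1 hcj
      have hi : i ∈ C := mem_filter.2
        ⟨mem_univ _, Relation.TransGen.trans_left hc hci, Relation.TransGen.head hij hjc⟩
      exact ⟨i, hi, Option.some.inj ((hs i hi).symm.trans hij)⟩
  -- A map of a finite set onto itself is injective.
  have hinj : Set.InjOn s C := card_image_iff.1 (by rw [himage])
  rw [← Matrix.exists_vecMul_eq_zero_iff]
  refine ⟨fun i => if i ∈ C then 1 else 0, fun h => ?_, ?_⟩
  · simpa [hcC] using congrFun h c
  · have hnC : n ∉ C := fun h => absurd (hs n h) (by simp [hn])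
    rw [Matrix.vecMul_eq_sum]
    have : ∀ i, (if i ∈ C then (1 : K) else 0) •
        ((Matrix.of fun i => arcRow K i (p i)).updateRow n u) i =
        if i ∈ C then Pi.single i 1 - Pi.single (s i) 1 else 0 := by
      intro i
      split_ifs with hi
      · have hne : i ≠ n := fun h => hnC (h ▸ hi)
        rw [one_smul, Matrix.updateRow_ne hne]
        change arcRow K i (p i) = _
        rw [arcRow, hs i hi]
        rfl
      · simp
    simp only [this]
    rw [← sum_filter, filter_mem_eq_inter, univ_inter, sum_sub_distrib, sub_eq_zero]
    conv_lhs => rw [← himage, sum_image hinj]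

end Determinants

/-! ### Tree counts and the forest expansion of the adjugate. -/

section Roots

variable {V : Type*} [DecidableEq V]

theorem not_isRootOf_of_hasWay {F : Finset (V × V)} {m n : V} (h : HasWay F m n) (hmn : m ≠ n) :
    ¬ IsRootOf F m := by
  rcases h.cases_head with h | ⟨j, hj, -⟩
  · exact absurd h hmn
  · rw [IsRootOf, outdegree, card_eq_zero]
    exact ne_empty_of_mem (mem_filter.2 ⟨hj, rfl⟩)

theorem mem_forests {A F : Finset (V × V)} {W : Finset V} {k : ℕ} :
    F ∈ forests A W k ↔
      F ⊆ A ∧ IsForest F ∧ numTrees F = k + W.card ∧ ∀ w ∈ W, IsRootOf F w := by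
  simp only [forests, mem_filter, mem_powerset]

end Roots

section ForestTheorem

variable {V K : Type*} [DecidableEq V] [Fintype V]

theorem numTrees_le_card {F : Finset (V × V)} (hF : IsForest F) :
    numTrees F ≤ Fintype.card V := by
  obtain ⟨p, rfl⟩ := exists_arcsOf_eq hF.outdegree_le_one
  rw [numTrees_arcsOf (isForest_arcsOf.1 hF)]
  exact card_le_univ _

theorem numTrees_lt_card {F : Finset (V × V)} (hF : IsForest F) {m : V} (hm : ¬ IsRootOf F m) :
    numTrees F < Fintype.card V := by
  obtain ⟨p, rfl⟩ := exists_arcsOf_eq hF.outdegree_le_one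
  rw [numTrees_arcsOf (isForest_arcsOf.1 hF), ← card_univ]
  rw [isRootOf_arcsOf] at hm
  exact card_lt_card (filter_ssubset.2 ⟨m, mem_univ _, hm⟩)

theorem card_le_numTrees {F : Finset (V × V)} (hF : IsForest F) {W : Finset V}
    (hW : ∀ w ∈ W, IsRootOf F w) : W.card ≤ numTrees F := by
  obtain ⟨p, rfl⟩ := exists_arcsOf_eq hF.outdegree_le_one
  rw [numTrees_arcsOf (isForest_arcsOf.1 hF)]
  refine card_le_card fun w hw => ?_
  simpa [isRootOf_arcsOf] using hW w hw

open Classical in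
/-- The spanning forests, with any number of trees, in which the elements of `W` are roots and
there is a way from `m` to `n`. -/
noncomputable def rootedForestsWay (A : Finset (V × V)) (W : Finset V) (m n : V) :
    Finset (Finset (V × V)) :=
  A.powerset.filter fun F => IsForest F ∧ (∀ w ∈ W, IsRootOf F w) ∧ HasWay F m n

theorem mem_rootedForestsWay {A F : Finset (V × V)} {W : Finset V} {m n : V} :
    F ∈ rootedForestsWay A W m n ↔
      F ⊆ A ∧ IsForest F ∧ (∀ w ∈ W, IsRootOf F w) ∧ HasWay F m n := by
  simp only [rootedForestsWay, mem_filter, mem_powerset]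

variable [Field K]

/-- The matrix with rows `x e_i + ∑ j, w i j (e_i - e_j)` for `i ∉ W` and `e_i` for `i ∈ W`. -/
def rootedLaplacian (w : V → V → K) (W : Finset V) (x : K) : Matrix V V K :=
  Matrix.of fun i => if i ∈ W then Pi.single i 1 else
    x • Pi.single i 1 + ∑ j, w i j • (Pi.single i 1 - Pi.single j 1)

/-- The weight of a root is `1` on `W` and `x` elsewhere. -/
def choiceWeight (w : V → V → K) (W : Finset V) (x : K) (i : V) (t : Option V) : K :=
  if i ∈ W then t.elim 1 0 else t.elim x (w i)

theorem rootedLaplacian_apply (w : V → V → K) (W : Finset V) (x : K) (i j : V) :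
    rootedLaplacian w W x i j = if i ∈ W then if i = j then 1 else 0 else
      x * (if i = j then 1 else 0) +
        ∑ k, w i k * ((if i = j then 1 else 0) - if k = j then 1 else 0) := by
  by_cases hi : i ∈ W <;>
    simp [rootedLaplacian, hi, Pi.single_apply, eq_comm (a := j)]

theorem rootedLaplacian_eq (w : V → V → K) (W : Finset V) (x : K) :
    rootedLaplacian w W x =
      Matrix.of fun i => ∑ t, choiceWeight w W x i t • arcRow K i t := by
  refine congrArg Matrix.of (funext fun i => ?_)
  rw [Fintype.sum_option]
  by_cases hi : i ∈ W <;> simp [choiceWeight, arcRow, hi]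

theorem prod_choiceWeight (w : V → V → K) {W : Finset V} (x : K) {p : V → Option V}
    (hW : ∀ i ∈ W, p i = none) (hp : ∀ i, ¬ Relation.TransGen (fun a b => p a = some b) i i) :
    ∏ i, choiceWeight w W x i (p i) =
      x ^ (numTrees (arcsOf p) - W.card) * productivity w (arcsOf p) := by
  have hsub : W ⊆ univ.filter fun i => p i = none := fun i hi => by simpa using hW i hi
  rw [numTrees_arcsOf hp, ← card_sdiff_of_subset hsub, productivity_arcsOf, ← prod_const,
    ← univ_inter ((univ.filter fun i => p i = none) \ W), ← prod_ite_mem, ← prod_mul_distrib]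
  refine prod_congr rfl fun i _ => ?_
  by_cases hi : i ∈ W
  · simp [choiceWeight, hi, hW i hi]
  · cases hpi : p i <;> simp [choiceWeight, hi, hpi]

theorem adjugate_rootedLaplacian {w : V → V → K} {A : Finset (V × V)} {W : Finset V} {n : V}
    (hA : ∀ a ∉ A, w a.1 a.2 = 0) (hn : n ∈ W) (m : V) (x : K) :
    (rootedLaplacian w W x).adjugate m n =
      ∑ F ∈ rootedForestsWay A W m n, x ^ (numTrees F - W.card) * productivity w F := by
  classical
  let P : (V → Option V) → Prop := fun p =>
    (∀ i, ¬ Relation.TransGen (fun a b => p a = some b) i i) ∧ (∀ i ∈ W, p i = none) ∧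
      Relation.ReflTransGen (fun a b => p a = some b) m n
  -- Row `n` becomes `e_m` whatever the choice there; since `n ∈ W`, the choice weights at `n` sum
  -- to 1.
  let b : V → Option V → V → K := fun i t => if i = n then Pi.single m 1 else arcRow K i t
  have hb : ∀ p : V → Option V, (Matrix.of fun i => b i (p i)) =
      (Matrix.of fun i => arcRow K i (p i)).updateRow n (Pi.single m 1) := by
    intro p
    ext i j
    by_cases hi : i = n <;> simp [b, hi, Matrix.updateRow_apply]
  have hrow : (rootedLaplacian w W x).updateRow n (Pi.single m 1) =
      Matrix.of fun i => ∑ t, choiceWeight w W x i t • b i t := by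
    rw [rootedLaplacian_eq]
    ext i j
    by_cases hi : i = n
    · subst hi
      simp [b, choiceWeight, hn, Fintype.sum_option]
    · simp [b, hi, Matrix.updateRow_apply]
  have hterm : ∀ p : V → Option V,
      (∏ i, choiceWeight w W x i (p i)) * (Matrix.of fun i => b i (p i)).det =
        if P p then x ^ (numTrees (arcsOf p) - W.card) * productivity w (arcsOf p) else 0 := by
    intro p
    by_cases hW : ∀ i ∈ W, p i = none
    · rw [hb]
      by_cases hp : ∀ i, ¬ Relation.TransGen (fun a b => p a = some b) i i
      · rw [det_arcRow_updateRow_of_acyclic (hW n hn) hp, prod_choiceWeight w x hW hp]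
        have : P p ↔ Relation.ReflTransGen (fun a b => p a = some b) m n :=
          ⟨fun h => h.2.2, fun h => ⟨hp, hW, h⟩⟩
        simp [this]
      · rw [if_neg fun h => hp h.1]
        push Not at hp
        obtain ⟨i, hi⟩ := hp
        rw [det_arcRow_updateRow_of_cyclic _ (hW n hn) hi, mul_zero]
    · rw [if_neg fun h => hW h.2.1]
      push Not at hW
      obtain ⟨i, hi, hpi⟩ := hW
      obtain ⟨j, hj⟩ := Option.ne_none_iff_exists'.1 hpi
      rw [prod_eq_zero (mem_univ i), zero_mul]
      simp [choiceWeight, hi, hj]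
  have himage : (univ.filter P).image arcsOf = rootedForestsWay univ W m n := by
    ext F
    simp only [mem_image, mem_filter, mem_univ, true_and, rootedForestsWay, mem_powerset,
      subset_univ]
    constructor
    · rintro ⟨p, ⟨hp, hW, hway⟩, rfl⟩
      exact ⟨isForest_arcsOf.2 hp, fun i hi => isRootOf_arcsOf.2 (hW i hi), hasWay_arcsOf.2 hway⟩
    · rintro ⟨hF, hW, hway⟩
      obtain ⟨p, rfl⟩ := exists_arcsOf_eq hF.outdegree_le_one
      exact ⟨p, ⟨isForest_arcsOf.1 hF, fun i hi => isRootOf_arcsOf.1 (hW i hi),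
        hasWay_arcsOf.1 hway⟩, rfl⟩
  rw [Matrix.adjugate_apply, hrow, det_sum_smul_rows, sum_congr rfl fun p _ => hterm p,
    ← sum_filter]
  rw [← sum_image (f := fun F => x ^ (numTrees F - W.card) * productivity w F)
    fun p _ q _ h => arcsOf_injective h, himage]
  symm
  -- The expansion ranges over all arcs; a forest using an arc outside `A` has productivity zero.
  refine sum_subset (filter_subset_filter _ (powerset_mono.2 (subset_univ _))) fun F hF hFA => ?_
  have hsub : ¬ F ⊆ A := fun h => hFA
    (mem_filter.2 ⟨mem_powerset.2 h, (mem_filter.1 hF).2⟩)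
  obtain ⟨a, ha, haA⟩ := not_subset.1 hsub
  rw [productivity, prod_eq_zero ha (hA a haA), mul_zero]

-- Grouping by `k = numTrees F - W.card`; the subtraction is not truncated, since each element of
-- `W` is the root of its own tree.
open Classical in
theorem sum_rootedForestsWay (w : V → V → K) (A : Finset (V × V)) (W : Finset V) (m n : V) (x : K)
    {B : ℕ} (hB : ∀ F ∈ rootedForestsWay A W m n, numTrees F < B + W.card) :
    ∑ F ∈ rootedForestsWay A W m n, x ^ (numTrees F - W.card) * productivity w F =
      ∑ k ∈ range B, x ^ k * ∑ F ∈ (forests A W k).filter fun F => HasWay F m n,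
        productivity w F := by
  have hle : ∀ F ∈ rootedForestsWay A W m n, W.card ≤ numTrees F := fun F hF =>
    card_le_numTrees (mem_filter.1 hF).2.1 (mem_filter.1 hF).2.2.1
  have hmaps : ∀ F ∈ rootedForestsWay A W m n, numTrees F - W.card ∈ range B := by
    intro F hF
    have := hB F hF
    have := hle F hF
    rw [mem_range]
    omega
  rw [← sum_fiberwise_of_maps_to hmaps]
  refine sum_congr rfl fun k _ => ?_
  have hset : (rootedForestsWay A W m n).filter (fun F => numTrees F - W.card = k) =
      (forests A W k).filter fun F => HasWay F m n := by
    ext F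
    constructor
    · intro hF
      obtain ⟨hF, hk⟩ := mem_filter.1 hF
      have := hle F hF
      obtain ⟨hFA, hfor, hW, hway⟩ := mem_filter.1 hF
      exact mem_filter.2 ⟨mem_forests.2 ⟨mem_powerset.1 hFA, hfor, by omega, hW⟩, hway⟩
    · intro hF
      obtain ⟨hF, hway⟩ := mem_filter.1 hF
      obtain ⟨hFA, hfor, hk, hW⟩ := mem_forests.1 hF
      exact mem_filter.2
        ⟨mem_filter.2 ⟨mem_powerset.2 hFA, hfor, hW, hway⟩, by omega⟩
  rw [← hset, mul_sum]
  exact sum_congr rfl fun F hF => by rw [(mem_filter.1 hF).2]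

end ForestTheorem

/-! ### From the Laplacian of `G†` to `x I - G`. -/

section DaggerForests

variable {K : Type*} [Field K] {N : ℕ}

theorem daggerWeight_eq_zero (G : Matrix (Fin N) (Fin N) K) :
    ∀ a ∉ daggerArcs G, daggerWeight G a.1 a.2 = 0 := by
  rintro ⟨_ | i, _ | j⟩ ha
  · rfl
  · rfl
  · simp [daggerArcs] at ha
  · simpa [daggerArcs, daggerWeight, Classical.not_imp] using ha

/-- The arc weights leaving `i` sum to `-G i i`, which gives the diagonal entry `x - G i i`. The row
of † is a unit vector, so it splits off as a block of determinant 1. -/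
theorem adjugate_rootedLaplacian_daggerWeight (G : Matrix (Fin N) (Fin N) K) (n m : Fin N)
    (x : K) :
    (rootedLaplacian (daggerWeight G) {some n, none} x).adjugate (some m) (some n) =
      (x • (1 : Matrix (Fin N) (Fin N) K) - G).adjugate m n := by
  rw [Matrix.adjugate_apply, Matrix.adjugate_apply]
  set L := (rootedLaplacian (daggerWeight G) {some n, none} x).updateRow (some n)
    (Pi.single (some m) 1) with hL
  set A := (x • (1 : Matrix (Fin N) (Fin N) K) - G).updateRow n (Pi.single m 1) with hA
  have hnone : ∀ j, L none j = if none = j then 1 else 0 := by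
    intro j
    simp [hL, rootedLaplacian_apply]
  have hsome : ∀ i j, L (some i) (some j) = A i j := by
    intro i j
    by_cases hi : i = n
    · subst hi
      simp [hL, hA, Pi.single_apply]
    · rw [hL, hA, Matrix.updateRow_ne (by simpa using hi), Matrix.updateRow_ne hi,
        rootedLaplacian_apply, if_neg (by simpa using hi), Fintype.sum_option]
      by_cases hij : i = j
      · subst hij
        have hsum : ∑ k, (if i = k then 0 else G i k * ((1 : K) - if k = i then 1 else 0)) =
            (∑ k, G i k) - G i i := by
          rw [eq_sub_iff_add_eq, ← Fintype.sum_ite_eq i (fun k => G i k), ← sum_add_distrib]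
          refine sum_congr rfl fun k _ => ?_
          rcases eq_or_ne i k with rfl | hik
          · simp
          · simp [hik, hik.symm]
        simp only [daggerWeight, hsum, Option.some.injEq, reduceCtorEq, if_true, if_false,
          mul_one, sub_zero, ite_mul, zero_mul, Matrix.sub_apply, Matrix.smul_apply,
          Matrix.one_apply_eq, smul_eq_mul]
        ring
      · simp [daggerWeight, hij]
  have hblocks : L = (Matrix.fromBlocks A (Matrix.of fun i (_ : Unit) => L (some i) none) 0
      (1 : Matrix Unit Unit K)).submatrix
        (Equiv.optionEquivSumPUnit (Fin N)) (Equiv.optionEquivSumPUnit (Fin N)) := by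
    ext (_ | i) (_ | j)
    · exact (hnone none).trans (if_pos rfl)
    · exact (hnone (some j)).trans (if_neg (Option.some_ne_none j).symm)
    · rfl
    · exact hsome i j
  rw [hblocks, Matrix.det_submatrix_equiv_self, Matrix.det_fromBlocks_zero₂₁, Matrix.det_one,
    mul_one]

theorem adjugate_eq_sum_rootedForestsWay (G : Matrix (Fin N) (Fin N) K) (n m : Fin N) (x : K) :
    (x • (1 : Matrix (Fin N) (Fin N) K) - G).adjugate m n =
      ∑ F ∈ rootedForestsWay (daggerArcs G) {some n, none} (some m) (some n),
        x ^ (numTrees F - ({some n, none} : Finset (Option (Fin N))).card) *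
          productivity (daggerWeight G) F := by
  rw [← adjugate_rootedLaplacian_daggerWeight,
    adjugate_rootedLaplacian (daggerWeight_eq_zero G) (by simp)]

theorem daggerForestsWay_self (G : Matrix (Fin N) (Fin N) K) (n : Fin N) (k : ℕ) :
    daggerForestsWay G n n k = daggerForests G n k := by
  ext F
  simp only [daggerForestsWay, mem_filter]
  exact and_iff_left .refl

theorem adjugate_self_eq_forestDen (G : Matrix (Fin N) (Fin N) K) (n : Fin N) (x : K) :
    (x • (1 : Matrix (Fin N) (Fin N) K) - G).adjugate n n = forestDen G n x := by
  rw [adjugate_eq_sum_rootedForestsWay, sum_rootedForestsWay (B := N)]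
  · refine sum_congr rfl fun k _ => ?_
    rw [← daggerForestsWay_self]
    rfl
  · intro F hF
    have := numTrees_le_card (mem_rootedForestsWay.1 hF).2.1
    rw [card_pair (Option.some_ne_none n)]
    rw [Fintype.card_option, Fintype.card_fin] at this
    omega

/-- A vertex `m ≠ n` with a way to `n` is not a root, which costs one tree and lowers the range to
`N - 1`. -/
theorem adjugate_eq_forestNum (G : Matrix (Fin N) (Fin N) K) {n m : Fin N} (hmn : m ≠ n) (x : K) :
    (x • (1 : Matrix (Fin N) (Fin N) K) - G).adjugate m n = forestNum G n m x := by
  rw [adjugate_eq_sum_rootedForestsWay, sum_rootedForestsWay (B := N - 1)]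
  · rfl
  · intro F hF
    obtain ⟨-, hfor, -, hway⟩ := mem_rootedForestsWay.1 hF
    have := numTrees_lt_card hfor
      (not_isRootOf_of_hasWay hway fun h => hmn (Option.some.inj h))
    rw [card_pair (Option.some_ne_none n)]
    rw [Fintype.card_option, Fintype.card_fin] at this
    have := n.pos
    omega

end DaggerForests

/-! ### Column replacement and the derivative of the characteristic polynomial. -/

section Adjugates

variable {ι K : Type*} [Fintype ι] [DecidableEq ι] [CommRing K]

theorem adjugate_apply_eq_det_updateCol (A : Matrix ι ι K) (i j : ι) :
    A.adjugate i j = (A.updateCol i (Pi.single j 1)).det := by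
  rw [← Matrix.cramer_apply, Matrix.cramer_eq_adjugate_mulVec, Matrix.mulVec_single_one,
    Matrix.col_apply]

/-- Both sides are determinants with a column replaced by `e_n`; swapping columns `m` and `n` gives
a sign that cancels the negation. -/
theorem adjugate_updateCol_neg (A : Matrix ι ι K) {n m : ι} (hmn : m ≠ n) :
    (A.updateCol m fun i => -A i n).adjugate n n = A.adjugate m n := by
  rw [adjugate_apply_eq_det_updateCol, adjugate_apply_eq_det_updateCol]
  set X := (A.updateCol m fun i => -A i n).updateCol n (Pi.single n 1) with hX
  have hswap : X.submatrix id (Equiv.swap m n) =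
      (A.updateCol m (Pi.single n 1)).updateCol n
        ((-1 : K) • fun i => (A.updateCol m (Pi.single n 1)) i n) := by
    ext i j
    rcases eq_or_ne j m with rfl | hjm
    · simp [hX, Matrix.updateCol_apply, hmn]
    · rcases eq_or_ne j n with rfl | hjn
      · simp [hX, hmn, hmn.symm]
      · simp [hX, Matrix.updateCol_apply, Equiv.swap_apply_of_ne_of_ne hjm hjn, hjm, hjn]
  have h := Matrix.det_permute' (Equiv.swap m n) X
  rw [hswap, Matrix.det_updateCol_smul, Matrix.updateCol_eq_self, Equiv.Perm.sign_swap hmn] at h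
  simpa using h.symm

open Polynomial in
theorem derivative_charpoly_eval (G : Matrix ι ι K) (x : K) :
    (derivative G.charpoly).eval x = ((x • (1 : Matrix ι ι K) - G).adjugate).trace := by
  have hentry : ∀ i j, derivative (G.charmatrix i j) = (Pi.single j 1 : ι → K[X]) i := by
    intro i j
    rw [Matrix.charmatrix_apply, Matrix.diagonal_apply, Pi.single_apply]
    split_ifs <;> simp
  -- Product rule in the Leibniz expansion: differentiating the factor from column `a` amounts to
  -- replacing that column by `e_a`.
  have hcharpoly : derivative G.charpoly = G.charmatrix.adjugate.trace := by
    simp only [Matrix.trace, Matrix.diag_apply, adjugate_apply_eq_det_updateCol, Matrix.det_apply',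
      Matrix.charpoly]
    rw [sum_comm, derivative_sum]
    refine sum_congr rfl fun σ _ => ?_
    rw [derivative_intCast_mul, derivative_prod_finset, mul_sum]
    refine sum_congr rfl fun a _ => ?_
    rw [← prod_erase_mul _ _ (mem_univ a), hentry, Matrix.updateCol_self]
    congr 2
    refine prod_congr rfl fun b hb => ?_
    rw [Matrix.updateCol_ne (ne_of_mem_erase hb)]
  have heval : (evalRingHom x).mapMatrix G.charmatrix = x • (1 : Matrix ι ι K) - G := by
    ext i j
    simp [Matrix.charmatrix_apply, Matrix.diagonal_apply, Matrix.one_apply, apply_ite (eval x)]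
  rw [hcharpoly, ← heval, ← RingHom.map_adjugate, ← coe_evalRingHom, Matrix.trace, Matrix.trace,
    map_sum]
  rfl

end Adjugates

/-! ### Minors, cofactors and the case `x = 0`. -/

section Minors

variable {K : Type*} [Field K] {M : ℕ}

theorem det_minorMatrix_self (A : Matrix (Fin (M + 1)) (Fin (M + 1)) K) (n : Fin (M + 1)) :
    (minorMatrix A n n).det = A.adjugate n n := by
  rw [Matrix.adjugate_fin_succ_eq_det_submatrix, Even.neg_one_pow ⟨_, rfl⟩, one_mul]
  rfl

theorem minorMatrix_smul_one_sub (G : Matrix (Fin (M + 1)) (Fin (M + 1)) K) (n : Fin (M + 1))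
    (x : K) :
    minorMatrix (x • (1 : Matrix (Fin (M + 1)) (Fin (M + 1)) K) - G) n n =
      x • (1 : Matrix (Fin M) (Fin M) K) - minorMatrix G n n := by
  ext i j
  simp [minorMatrix, Matrix.one_apply]

theorem det_cramerMatrix (G : Matrix (Fin (M + 1)) (Fin (M + 1)) K) {n m : Fin (M + 1)}
    (hmn : m ≠ n) (x : K) :
    (cramerMatrix G n m x).det =
      (x • (1 : Matrix (Fin (M + 1)) (Fin (M + 1)) K) - G).adjugate m n := by
  rw [cramerMatrix, det_minorMatrix_self, adjugate_updateCol_neg _ hmn]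

theorem sum_range_zero_pow {B : ℕ} (hB : 0 < B) (f : ℕ → K) :
    ∑ k ∈ range B, (0 : K) ^ k * f k = f 0 := by
  rw [sum_eq_single_of_mem 0 (mem_range.2 hB) fun k _ hk => by rw [zero_pow hk, zero_mul],
    pow_zero, one_mul]

theorem adjugate_eq_sum_daggerForestsWay (G : Matrix (Fin (M + 1)) (Fin (M + 1)) K)
    (n m : Fin (M + 1)) :
    G.adjugate m n = (-1) ^ M *
      ∑ F ∈ daggerForestsWay G n m 0, productivity (daggerWeight G) F := by
  have hneg : G = (-1 : K) • ((0 : K) • (1 : Matrix (Fin (M + 1)) (Fin (M + 1)) K) - G) := by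
    simp
  conv_lhs => rw [hneg, Matrix.adjugate_smul]
  rw [Fintype.card_fin, Nat.add_sub_cancel, Matrix.smul_apply, smul_eq_mul]
  congr 1
  by_cases hmn : m = n
  · subst hmn
    rw [adjugate_self_eq_forestDen, forestDen, sum_range_zero_pow (Nat.succ_pos M),
      daggerForestsWay_self]
  · have hM : 0 < M + 1 - 1 := by
      have := Fin.val_ne_of_ne hmn
      omega
    rw [adjugate_eq_forestNum G hmn, forestNum, sum_range_zero_pow hM]

theorem det_minorMatrix_eq_adjugate (G : Matrix (Fin (M + 1)) (Fin (M + 1)) K)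
    (n m : Fin (M + 1)) :
    (minorMatrix G n m).det = (-1) ^ ((m : ℕ) + (n : ℕ)) * G.adjugate m n := by
  rw [Matrix.adjugate_fin_succ_eq_det_submatrix, ← mul_assoc, ← pow_add, add_comm (m : ℕ),
    Even.neg_one_pow ⟨_, rfl⟩, one_mul]
  rfl

end Minors

/-! ### Kernel vectors and simple eigenvalues. -/

section Eigenvectors

variable {ι K : Type*} [Fintype ι] [DecidableEq ι] [Field K]

/-- Replacing row `j` by `v_m e_n - v_n e_m` leaves `v` in the kernel; linearity of the vanishing
determinant in that row gives the identity. -/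
theorem mul_adjugate_eq_of_mulVec_eq_zero {A : Matrix ι ι K} {v : ι → K} (hv : v ≠ 0)
    (hA : A.mulVec v = 0) (n m j : ι) : v m * A.adjugate n j = v n * A.adjugate m j := by
  have h : (A.updateRow j (v m • Pi.single n 1 + (-v n) • Pi.single m 1)).det = 0 := by
    refine Matrix.exists_mulVec_eq_zero_iff.1 ⟨v, hv, ?_⟩
    ext i
    by_cases hi : i = j
    · subst hi
      rw [Matrix.mulVec, Matrix.updateRow_self, add_dotProduct, smul_dotProduct, smul_dotProduct,
        single_one_dotProduct, single_one_dotProduct, smul_eq_mul, smul_eq_mul, Pi.zero_apply]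
      ring
    · simpa [Matrix.mulVec, Matrix.updateRow_ne hi] using congrFun hA i
  rw [Matrix.det_updateRow_add, Matrix.det_updateRow_smul, Matrix.det_updateRow_smul,
    ← Matrix.adjugate_apply, ← Matrix.adjugate_apply] at h
  linear_combination h

theorem mul_adjugate_eq_of_vecMul_eq_zero {A : Matrix ι ι K} {w : ι → K} (hw : w ≠ 0)
    (hA : Matrix.vecMul w A = 0) (n m j : ι) : w m * A.adjugate j n = w n * A.adjugate j m := by
  have := mul_adjugate_eq_of_mulVec_eq_zero (A := A.transpose) hw
    (by rw [Matrix.mulVec_transpose, hA]) n m j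
  simpa [← Matrix.adjugate_transpose] using this

theorem trace_adjugate_ne_zero {G : Matrix ι ι K} {x : K} (h : G.charpoly.rootMultiplicity x = 1) :
    ((x • (1 : Matrix ι ι K) - G).adjugate).trace ≠ 0 := by
  rw [← derivative_charpoly_eval]
  intro h0
  have hroot : G.charpoly.IsRoot x := by
    rw [← Polynomial.rootMultiplicity_pos G.charpoly_monic.ne_zero, h]
    exact one_pos
  have := (Polynomial.one_lt_rootMultiplicity_iff_isRoot G.charpoly_monic.ne_zero).2 ⟨hroot, h0⟩
  omega

/-- Row `n` of the adjugate is itself a left kernel vector. Conversely, if `v n` and `w n` are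
nonzero but the `n`-th diagonal entry vanishes, proportionality along columns and rows kills the
whole diagonal, contradicting the nonzero trace. -/
theorem adjugate_diag_ne_zero_iff {G : Matrix ι ι K} {x : K}
    (h : G.charpoly.rootMultiplicity x = 1) {v : ι → K}
    (hv : (x • (1 : Matrix ι ι K) - G).mulVec v = 0) {n : ι} (hn : v n ≠ 0) :
    (x • (1 : Matrix ι ι K) - G).adjugate n n ≠ 0 ↔
      ∃ w : ι → K, Matrix.vecMul w G = x • w ∧ w n ≠ 0 := by
  have htrace := trace_adjugate_ne_zero h
  set A := x • (1 : Matrix ι ι K) - G with hA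
  have hv0 : v ≠ 0 := fun h0 => hn (by rw [h0]; rfl)
  have hleft : ∀ w : ι → K, Matrix.vecMul w A = x • w - Matrix.vecMul w G := by
    intro w
    rw [hA, Matrix.vecMul_sub, Matrix.vecMul_smul, Matrix.vecMul_one]
  constructor
  · intro hadj
    refine ⟨A.adjugate n, ?_, hadj⟩
    have hdet : A.det = 0 := Matrix.exists_mulVec_eq_zero_iff.1 ⟨v, hv0, hv⟩
    have hrow : Matrix.vecMul (A.adjugate n) A = 0 := by
      have := congrFun (Matrix.adjugate_mul A) n
      rw [hdet, zero_smul] at this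
      exact this
    rw [hleft, sub_eq_zero] at hrow
    exact hrow.symm
  · rintro ⟨w, hw, hwn⟩ hadj
    have hw0 : w ≠ 0 := fun h0 => hwn (by rw [h0]; rfl)
    have hwA : Matrix.vecMul w A = 0 := by rw [hleft, hw, sub_self]
    refine htrace (sum_eq_zero fun j _ => ?_)
    have h1 : A.adjugate j n = 0 := by
      have := mul_adjugate_eq_of_mulVec_eq_zero hv0 hv n j n
      rw [hadj, mul_zero] at this
      exact (mul_eq_zero.1 this.symm).resolve_left hn
    have h2 := mul_adjugate_eq_of_vecMul_eq_zero hw0 hwA n j j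
    rw [h1, mul_zero] at h2
    exact (mul_eq_zero.1 h2.symm).resolve_left hwn

theorem exists_adjugate_diag_ne_zero {G : Matrix ι ι K} {x : K}
    (h : G.charpoly.rootMultiplicity x = 1) {v : ι → K} (hv0 : v ≠ 0)
    (hv : (x • (1 : Matrix ι ι K) - G).mulVec v = 0) :
    ∃ n, v n ≠ 0 ∧ (x • (1 : Matrix ι ι K) - G).adjugate n n ≠ 0 := by
  obtain ⟨n, -, hn⟩ := exists_ne_zero_of_sum_ne_zero (trace_adjugate_ne_zero h)
  refine ⟨n, fun hvn => ?_, hn⟩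
  obtain ⟨m, hm⟩ := Function.ne_iff.1 hv0
  have := mul_adjugate_eq_of_mulVec_eq_zero hv0 hv n m n
  rw [hvn, zero_mul] at this
  exact (mul_ne_zero hm hn) this

end Eigenvectors

end TreeLike

/-- With `N = M + 1`, the exponent `M + m + n` has the parity of `N + m - n - 1` and avoids
subtraction. -/
theorem theorem2 {K : Type*} [Field K] (M : ℕ) (G : Matrix (Fin (M + 1)) (Fin (M + 1)) K) :
    -- the components of an eigenvector of a simple eigenvalue
    (∀ (lam : K) (v : Fin (M + 1) → K),
      G.charpoly.rootMultiplicity lam = 1 →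
      Module.End.HasEigenvector (Matrix.toLin' G) lam v →
      (∀ n, v n ≠ 0 →
        (∀ m, m ≠ n → v m * TreeLike.forestDen G n lam = v n * TreeLike.forestNum G n m lam) ∧
        (TreeLike.forestDen G n lam ≠ 0 →
          ∀ m, m ≠ n → v m / v n = TreeLike.forestNum G n m lam / TreeLike.forestDen G n lam) ∧
        (TreeLike.forestDen G n lam ≠ 0 ↔
          ∃ w : Fin (M + 1) → K, Matrix.vecMul w G = lam • w ∧ w n ≠ 0)) ∧
      ∃ n, v n ≠ 0 ∧ TreeLike.forestDen G n lam ≠ 0) ∧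
    -- the characteristic determinant of `G_{nn}`
    (∀ (n : Fin (M + 1)) (x : K),
      (x • (1 : Matrix (Fin M) (Fin M) K) - TreeLike.minorMatrix G n n).det =
        TreeLike.forestDen G n x) ∧
    -- the numerator determinant in Cramer's rule
    (∀ (n m : Fin (M + 1)) (x : K), m ≠ n →
      (TreeLike.cramerMatrix G n m x).det = TreeLike.forestNum G n m x) ∧
    -- the minors, and the cofactors (entry `(m, n)` of the adjugate is the cofactor of `G n m`)
    (∀ n m : Fin (M + 1),
      (TreeLike.minorMatrix G n m).det =
        (-1) ^ (M + (m : ℕ) + (n : ℕ)) *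
          ∑ F ∈ TreeLike.daggerForestsWay G n m 0,
            TreeLike.productivity (TreeLike.daggerWeight G) F ∧
      G.adjugate m n =
        (-1) ^ M *
          ∑ F ∈ TreeLike.daggerForestsWay G n m 0,
            TreeLike.productivity (TreeLike.daggerWeight G) F) := by
  refine ⟨fun lam v hsimple hv => ?_, fun n x => ?_, fun n m x hmn => ?_, fun n m => ⟨?_, ?_⟩⟩
  · have hker : (lam • (1 : Matrix (Fin (M + 1)) (Fin (M + 1)) K) - G).mulVec v = 0 := by
      have := hv.apply_eq_smul
      rw [Matrix.toLin'_apply] at this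
      rw [Matrix.sub_mulVec, Matrix.smul_mulVec, Matrix.one_mulVec, this, sub_self]
    have hmul : ∀ n m, m ≠ n →
        v m * TreeLike.forestDen G n lam = v n * TreeLike.forestNum G n m lam := by
      intro n m hmn
      rw [← TreeLike.adjugate_self_eq_forestDen, ← TreeLike.adjugate_eq_forestNum G hmn]
      exact TreeLike.mul_adjugate_eq_of_mulVec_eq_zero hv.2 hker n m n
    refine ⟨fun n hn => ⟨hmul n, fun hD m hmn => ?_, ?_⟩, ?_⟩
    · rw [div_eq_div_iff hn hD, hmul n m hmn, mul_comm]
    · rw [← TreeLike.adjugate_self_eq_forestDen]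
      exact TreeLike.adjugate_diag_ne_zero_iff hsimple hker hn
    · obtain ⟨n, hn, hadj⟩ := TreeLike.exists_adjugate_diag_ne_zero hsimple hv.2 hker
      exact ⟨n, hn, by rwa [← TreeLike.adjugate_self_eq_forestDen]⟩
  · rw [← TreeLike.minorMatrix_smul_one_sub, TreeLike.det_minorMatrix_self,
      TreeLike.adjugate_self_eq_forestDen]
  · rw [TreeLike.det_cramerMatrix G hmn, TreeLike.adjugate_eq_forestNum G hmn]
  · rw [TreeLike.det_minorMatrix_eq_adjugate, TreeLike.adjugate_eq_sum_daggerForestsWay,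
      ← mul_assoc, ← pow_add]
    congr 2
    ring
  · exact TreeLike.adjugate_eq_sum_daggerForestsWay G n m
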